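/- Let $(R,\mathfrak m,k)$ be a commutative noetherian local ring. A cochain complex $M=(M^i)_{i\in\mathbb Z}$ of $R$-modules is called \emph{maximal Cohen--Macaulay} (MCM) if the following conditions hold: \begin{enumerate} \item $H^i(M)=0$ for all but finitely many $i$; \item the natural map $H^0(M)\to H^0(k\otimes^{\mathsf L}_R M)$ is nonzero; \item $H^i_{\mathfrak m}(M)=0$ for all integers $i\ne \dim R$, where $H^i_{\mathfrak m}(M)=H^i(\mathsf R\Gamma_{\mathfrak m}M)$ is the local cohomology of the complex $M$, that is, $H^i$ of the subcomplex of $\mathfrak m$-power torsion elements of a semi-injective resolution of $M$; \item each $H^i(M)$ is a finitely generated $R$-module. \end{enumerate} \textbf{Lemma.} If $M$ is an MCM complex over $R$, then $H^i(M)=0$ for every integer $i\notin[0,\dim R]$; moreover, $H^0(M)\neq 0$. -/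

import Mathlib

open CategoryTheory

universe u

noncomputable section

namespace MCM

/-- The submodule of `I`-power torsion elements: `{m ∈ M | I ^ n m = 0 for some n ≥ 0}`. -/
def powerTorsion {R : Type u} [CommRing R] (I : Ideal R) (M : Type u) [AddCommGroup M]
    [Module R M] : Submodule R M where
  carrier := {m | ∃ n : ℕ, ∀ a ∈ I ^ n, a • m = 0}
  zero_mem' := ⟨0, fun a _ => smul_zero a⟩
  add_mem' := by
    rintro x y ⟨n, hn⟩ ⟨p, hp⟩
    refine ⟨n + p, fun a ha => ?_⟩
    rw [smul_add, hn a (Ideal.pow_le_pow_right (Nat.le_add_right n p) ha),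
      hp a (Ideal.pow_le_pow_right (Nat.le_add_left p n) ha), add_zero]
  smul_mem' := by
    rintro c x ⟨n, hn⟩
    exact ⟨n, fun a ha => by rw [smul_comm, hn a ha, smul_zero]⟩

/-- The `I`-power torsion functor `Γ_I` on `R`-modules. -/
def torsionFunctor {R : Type u} [CommRing R] (I : Ideal R) : ModuleCat.{u} R ⥤ ModuleCat.{u} R where
  obj M := ModuleCat.of R (powerTorsion I M)
  map {M N} f := ModuleCat.ofHom (f.hom.restrict (p := powerTorsion I M) (q := powerTorsion I N)
    (by
      rintro x ⟨n, hn⟩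
      exact ⟨n, fun a ha => by rw [← map_smul, hn a ha, map_zero]⟩))
  map_id _ := rfl
  map_comp _ _ := rfl

instance {R : Type u} [CommRing R] (I : Ideal R) : (torsionFunctor I).Additive where
  map_add := rfl

/-- A semi-injective resolution `M ⟶ J`: a quasi-isomorphism to a K-injective complex
of injective modules. -/
structure SemiInjectiveResolution {R : Type u} [CommRing R]
    (M : CochainComplex (ModuleCat.{u} R) ℤ) where
  /-- the resolving complex -/
  J : CochainComplex (ModuleCat.{u} R) ℤ
  /-- the augmentation -/
  ι : M ⟶ J
  quasiIso : QuasiIso ι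
  isKInjective : J.IsKInjective
  injective : ∀ i : ℤ, Injective (J.X i)

/-- A semi-projective resolution `P ⟶ M`: a quasi-isomorphism from a K-projective complex
of projective modules. -/
structure SemiProjectiveResolution {R : Type u} [CommRing R]
    (M : CochainComplex (ModuleCat.{u} R) ℤ) where
  /-- the resolving complex -/
  P : CochainComplex (ModuleCat.{u} R) ℤ
  /-- the augmentation -/
  π : P ⟶ M
  quasiIso : QuasiIso π
  isKProjective : P.IsKProjective
  projective : ∀ i : ℤ, Projective (P.X i)

/-- The local cohomology module `H^i_I(M) = H^i(RΓ_I M)`, with `RΓ_I M = Γ_I J` computed from a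
semi-injective resolution `M ⟶ J`; up to isomorphism it does not depend on the resolution. -/
def SemiInjectiveResolution.localCohomology {R : Type u} [CommRing R]
    {M : CochainComplex (ModuleCat.{u} R) ℤ} (J : SemiInjectiveResolution M) (I : Ideal R)
    (i : ℤ) : ModuleCat.{u} R :=
  (((torsionFunctor I).mapHomologicalComplex (ComplexShape.up ℤ)).obj J.J).homology i

section Residue

variable (R : Type u) [CommRing R] [IsLocalRing R]

/-- The functor `k ⊗_R -` on `R`-modules, with `k` the residue field of `R`. -/
def residueTensor : ModuleCat.{u} R ⥤ ModuleCat.{u} R :=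
  MonoidalCategory.tensorLeft (ModuleCat.of R (IsLocalRing.ResidueField R))

instance : (residueTensor R).Additive :=
  inferInstanceAs (MonoidalCategory.tensorLeft _).Additive

/-- The natural map `N ⟶ k ⊗_R N`, `x ↦ 1 ⊗ x`. -/
def toResidueTensor : 𝟭 (ModuleCat.{u} R) ⟶ residueTensor R where
  app N := ModuleCat.ofHom (TensorProduct.mk R (IsLocalRing.ResidueField R) N 1)
  naturality _ _ _ := rfl

end Residue

/-- The complex `k ⊗ᴸ_R M`, computed as `k ⊗_R P` from a semi-projective resolution `P ⟶ M`. -/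
def SemiProjectiveResolution.residueTensor {R : Type u} [CommRing R] [IsLocalRing R]
    {M : CochainComplex (ModuleCat.{u} R) ℤ} (P : SemiProjectiveResolution M) :
    CochainComplex (ModuleCat.{u} R) ℤ :=
  ((MCM.residueTensor R).mapHomologicalComplex (ComplexShape.up ℤ)).obj P.P

/-- The natural map of complexes `P ⟶ k ⊗_R P`. -/
def SemiProjectiveResolution.toResidueTensor {R : Type u} [CommRing R] [IsLocalRing R]
    {M : CochainComplex (ModuleCat.{u} R) ℤ} (P : SemiProjectiveResolution M) :
    P.P ⟶ P.residueTensor where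
  f i := (MCM.toResidueTensor R).app (P.P.X i)
  comm' i j _ := ((MCM.toResidueTensor R).naturality (P.P.d i j)).symm

/-- The natural map `H^i(M) ⟶ H^i(k ⊗ᴸ_R M)`. -/
def SemiProjectiveResolution.residueMap {R : Type u} [CommRing R] [IsLocalRing R]
    {M : CochainComplex (ModuleCat.{u} R) ℤ} (P : SemiProjectiveResolution M) (i : ℤ) :
    M.homology i ⟶ P.residueTensor.homology i :=
  haveI := P.quasiIso
  inv (HomologicalComplex.homologyMap P.π i) ≫
    HomologicalComplex.homologyMap P.toResidueTensor i

/-- The Krull dimension as an integer; see `coe_dim` for the noetherian local case. -/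
def dim (R : Type u) [CommRing R] : ℤ := (((ringKrullDim R).unbotD 0).toNat : ℤ)

theorem coe_dim (R : Type u) [CommRing R] [IsLocalRing R] [IsNoetherianRing R] :
    ∃ d : ℕ, ringKrullDim R = d ∧ dim R = d := by
  obtain ⟨d, hd⟩ : ∃ d : ℕ, ringKrullDim R = d := by
    obtain ⟨d, hd⟩ := WithBot.ne_bot_iff_exists.mp (ringKrullDim_ne_bot (R := R))
    obtain ⟨n, hn⟩ := ENat.ne_top_iff_exists.mp (show d ≠ ⊤ by
      rintro rfl
      exact (ringKrullDim_ne_top (R := R)) hd.symm)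
    exact ⟨n, by rw [← hd, ← hn]; rfl⟩
  exact ⟨d, hd, by simp [dim, hd]⟩

/-- Big Cohen-Macaulay complexes over a (noetherian) local ring `(R, 𝔪, k)`. The objects
`k ⊗ᴸ_R M` and `RΓ_𝔪 M` do not depend, up to isomorphism, on the resolutions used. -/
structure IsBigCohenMacaulay {R : Type u} [CommRing R] [IsLocalRing R]
    (M : CochainComplex (ModuleCat.{u} R) ℤ) : Prop where
  /-- the cohomology of `M` is bounded -/
  bounded : ∃ a b : ℤ, ∀ i : ℤ, i < a ∨ b < i → Limits.IsZero (M.homology i)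
  /-- the natural map `H⁰(M) ⟶ H⁰(k ⊗ᴸ_R M)` is nonzero -/
  residueMap_ne_zero : ∃ P : SemiProjectiveResolution M, P.residueMap 0 ≠ 0
  /-- `H^i_𝔪(M) = 0` for `i ≠ dim R` -/
  localCohomology_isZero : ∃ J : SemiInjectiveResolution M, ∀ i : ℤ, i ≠ dim R →
    Limits.IsZero (J.localCohomology (IsLocalRing.maximalIdeal R) i)

/-- Maximal Cohen-Macaulay (MCM) complexes: big Cohen-Macaulay complexes with finitely generated
cohomology. As the cohomology is bounded, `⨁ i, H^i(M)` is finitely generated if and only if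
each `H^i(M)` is. -/
structure IsMaximalCohenMacaulay {R : Type u} [CommRing R] [IsLocalRing R]
    (M : CochainComplex (ModuleCat.{u} R) ℤ) : Prop extends IsBigCohenMacaulay M where
  /-- the cohomology of `M` is finitely generated -/
  finite : ∀ i : ℤ, Module.Finite R (M.homology i)

end MCM

end

namespace MCM

/-! Replace `M` by a semi-injective resolution `J`, and let `xs` be a system of parameters, of
length `d = dim R`. Two facts about the Koszul complex on `xs` give the vanishing.

The inclusion of `Γ_{(xs)} J` in `J` becomes a quasi-isomorphism after the Koszul construction
(`Sub.relAcyclic_koszul_torsion`): adjoining one `y` of `xs` at a time, `y` acts bijectively on `Γ_I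
E / Γ_{I+(y)} E` for `E` injective, by Artin–Rees. Cones here sit in degrees `-1` and `0`, so Koszul
cohomology in degree `i` vanishes once `H^j_𝔪(M) = 0` for `i ≤ j ≤ i + d`, which holds unless `i ≤ d
≤ i + d`, i.e. `0 ≤ i ≤ d`.

By Nakayama, finitely generated cohomology vanishes wherever the Koszul cohomology does
(`subsingleton_cohomology_of_koszul`).

Nonvanishing in degree `0` is immediate: a nonzero map has a nonzero source. -/

/-- A complex of `R`-modules given by its terms and differentials. -/
structure ModComplex (R : Type u) [CommRing R] where
  /-- the terms -/
  X : ℤ → Type u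
  [addCommGroup : ∀ i, AddCommGroup (X i)]
  [module : ∀ i, Module R (X i)]
  /-- the differential -/
  d : ∀ i, X i →ₗ[R] X (i + 1)
  d_d : ∀ i x, d (i + 1) (d i x) = 0

attribute [instance] ModComplex.addCommGroup ModComplex.module

/-! ### Koszul complexes and Nakayama's lemma -/

namespace ModComplex

variable {R : Type u} [CommRing R]

/-- The mapping cone of multiplication by `x` on `C`. -/
def cone (x : R) (C : ModComplex R) : ModComplex R where
  X i := C.X i × C.X (i + 1)
  d i := ((C.d i).coprod (x • LinearMap.id)).prod (-(C.d (i + 1) ∘ₗ LinearMap.snd R _ _))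
  d_d i c := by
    ext
    · simp [C.d_d]
    · simp [C.d_d]

@[simp]
theorem cone_d_apply (x : R) (C : ModComplex R) (i : ℤ) (c : C.X i × C.X (i + 1)) :
    (C.cone x).d i c = (C.d i c.1 + x • c.2, -C.d (i + 1) c.2) := rfl

/-- The Koszul complex on a list of elements with coefficients in `C`, as an iterated cone. -/
def koszul : List R → ModComplex R → ModComplex R
  | [], C => C
  | x :: xs, C => koszul xs (C.cone x)

/-- The cohomology of `C` in degree `i + 1`. -/
abbrev cohomology (C : ModComplex R) (i : ℤ) : Type u :=
  LinearMap.ker (C.d (i + 1)) ⧸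
    LinearMap.range ((C.d i).codRestrict (LinearMap.ker (C.d (i + 1)))
      fun c => LinearMap.mem_ker.mpr (C.d_d i c))

/-- The long exact sequence of the cone: its cohomology is the middle term of an exact sequence
between two cohomologies of `C`. This keeps Nakayama available at every stage of the iterated cone.
-/
theorem isNoetherian_cohomology_cone {C : ModComplex R} (x : R) {i : ℤ}
    (h₀ : IsNoetherian R (C.cohomology i)) (h₁ : IsNoetherian R (C.cohomology (i + 1))) :
    IsNoetherian R ((C.cone x).cohomology i) := by
  let f : C.cohomology i →ₗ[R] (C.cone x).cohomology i :=
    Submodule.mapQ _ _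
      (((LinearMap.inl R (C.X (i + 1)) (C.X (i + 1 + 1))).restrict (p := LinearMap.ker (C.d (i + 1)))
        (q := LinearMap.ker ((C.cone x).d (i + 1))) (fun a ha => by
          have ha' : C.d (i + 1) a = 0 := ha
          change (C.cone x).d (i + 1) (a, 0) = 0
          rw [cone_d_apply]
          simp [ha']
          rfl)))
      (by
        rintro _ ⟨b, rfl⟩
        refine ⟨(b, 0), Subtype.ext ?_⟩
        change (C.cone x).d i (b, 0) = (C.d i b, 0)
        exact Prod.ext (by simp) (by simp))
  let g : (C.cone x).cohomology i →ₗ[R] C.cohomology (i + 1) :=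
    Submodule.mapQ _ _
      (((LinearMap.snd R (C.X (i + 1)) (C.X (i + 1 + 1))).restrict
        (p := LinearMap.ker ((C.cone x).d (i + 1))) (q := LinearMap.ker (C.d (i + 1 + 1)))
        (fun a ha => by
          have ha' : (C.cone x).d (i + 1) a = 0 := ha
          exact neg_eq_zero.mp (congrArg Prod.snd ha'))))
      (by
        rintro _ ⟨b, rfl⟩
        refine ⟨-b.2, Subtype.ext ?_⟩
        change C.d (i + 1) (-b.2) = -C.d (i + 1) b.2
        simp)
  refine isNoetherian_of_range_eq_ker f g (le_antisymm ?_ ?_)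
  · rintro _ ⟨a, rfl⟩
    obtain ⟨a, rfl⟩ := Submodule.mkQ_surjective _ a
    have : g (f (Submodule.Quotient.mk a)) = Submodule.Quotient.mk 0 := rfl
    simpa using this
  · intro c hc
    obtain ⟨⟨⟨a, b⟩, hab⟩, rfl⟩ := Submodule.mkQ_surjective _ c
    have hab' : (C.cone x).d (i + 1) (a, b) = 0 := hab
    obtain ⟨β, hβ⟩ := (Submodule.Quotient.mk_eq_zero _).mp hc
    have hβ' : C.d (i + 1) β = b := congrArg Subtype.val hβ
    have h1 : C.d (i + 1) a + x • b = 0 := congrArg Prod.fst hab'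
    -- Adding the boundary of `(0, β)`, which is `(x • β, -b)`, to `(a, b)` clears the second
    -- coordinate.
    refine ⟨Submodule.Quotient.mk ⟨a + x • β, ?_⟩, ?_⟩
    · simp [hβ', h1]
    · refine (Submodule.Quotient.eq _).mpr ⟨(0, β), Subtype.ext ?_⟩
      change (C.cone x).d i (0, β) = (a + x • β, 0) - (a, b)
      refine Prod.ext ?_ ?_
      · change C.d i 0 + x • β = a + x • β - a
        simp
      · change -C.d (i + 1) β = 0 - b
        simp [hβ']

theorem subsingleton_cohomology_iff {C : ModComplex R} {i : ℤ} :
    Subsingleton (C.cohomology i) ↔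
      ∀ c : C.X (i + 1), C.d (i + 1) c = 0 → ∃ b, C.d i b = c := by
  rw [Submodule.Quotient.subsingleton_iff, LinearMap.range_eq_top]
  constructor
  · intro h c hc
    obtain ⟨b, hb⟩ := h ⟨c, hc⟩
    exact ⟨b, congrArg Subtype.val hb⟩
  · rintro h ⟨c, hc⟩
    obtain ⟨b, hb⟩ := h c hc
    exact ⟨b, Subtype.ext hb⟩

/-- If the cocycle `(c, 0)` bounds `(a, b)`, then `c = d a + x • b` with `d b = 0`, so the class of
`c` lies in `x` times the cohomology; Nakayama concludes. -/
theorem subsingleton_cohomology_of_cone [IsLocalRing R] {C : ModComplex R} {x : R} {i : ℤ}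
    (hx : x ∈ IsLocalRing.maximalIdeal R) (hC : IsNoetherian R (C.cohomology i))
    (h : Subsingleton ((C.cone x).cohomology i)) : Subsingleton (C.cohomology i) := by
  rw [subsingleton_cohomology_iff] at h
  refine (Submodule.subsingleton_iff R).mp (subsingleton_of_bot_eq_top (Eq.symm ?_))
  refine Submodule.eq_bot_of_le_smul_of_le_jacobson_bot (IsLocalRing.maximalIdeal R) ⊤
    (IsNoetherian.noetherian _) ?_ (IsLocalRing.maximalIdeal_le_jacobson _)
  rintro c -
  obtain ⟨⟨c, hc⟩, rfl⟩ := Submodule.mkQ_surjective _ c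
  have hc' : C.d (i + 1) c = 0 := hc
  obtain ⟨⟨a, b⟩, hab⟩ := h (c, 0) (by rw [cone_d_apply]; simp [hc']; rfl)
  rw [cone_d_apply] at hab
  have h1 : C.d i a + x • b = c := congrArg Prod.fst hab
  have h2 : C.d (i + 1) b = 0 := by simpa using! congrArg Prod.snd hab
  have : (Submodule.mkQ _ ⟨c, hc⟩ : C.cohomology i) =
      x • (Submodule.Quotient.mk ⟨b, h2⟩ : C.cohomology i) := by
    refine (Submodule.Quotient.eq _).mpr ⟨a, Subtype.ext ?_⟩
    change C.d i a = c - x • b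
    rw [← h1, add_sub_cancel_right]
  rw [this]
  exact Submodule.smul_mem_smul hx trivial

theorem subsingleton_cohomology_of_koszul [IsLocalRing R] (xs : List R) {C : ModComplex R}
    {i : ℤ} (hx : ∀ x ∈ xs, x ∈ IsLocalRing.maximalIdeal R)
    (hC : ∀ i, IsNoetherian R (C.cohomology i))
    (h : Subsingleton ((koszul xs C).cohomology i)) : Subsingleton (C.cohomology i) := by
  induction xs generalizing C with
  | nil => exact h
  | cons x xs ih =>
    exact subsingleton_cohomology_of_cone (hx x (by simp)) (hC i)
      (ih (fun y hy => hx y (by simp [hy]))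
        (fun i => isNoetherian_cohomology_cone x (hC i) (hC (i + 1))) h)

/-! ### Subcomplexes and relative acyclicity -/

/-- A subcomplex. -/
structure Sub (C : ModComplex R) where
  /-- the terms -/
  carrier : ∀ i, Submodule R (C.X i)
  d_mem : ∀ i, ∀ c ∈ carrier i, C.d i c ∈ carrier (i + 1)

namespace Sub

variable {C : ModComplex R}

/-- The cone of multiplication by `x` on a subcomplex. -/
def cone (x : R) (D : C.Sub) : (C.cone x).Sub where
  carrier i := (D.carrier i).prod (D.carrier (i + 1))
  d_mem _ _ hc := ⟨add_mem (D.d_mem _ _ hc.1) (Submodule.smul_mem _ _ hc.2),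
    neg_mem (D.d_mem _ _ hc.2)⟩

/-- The Koszul complex with coefficients in a subcomplex. -/
def koszul : ∀ (xs : List R) {C : ModComplex R}, C.Sub → (ModComplex.koszul xs C).Sub
  | [], _, D => D
  | x :: xs, _, D => koszul xs (D.cone x)

/-- The cohomology of `D` vanishes in degree `i + 1`. -/
def ExactAt (D : C.Sub) (i : ℤ) : Prop :=
  ∀ c ∈ D.carrier (i + 1), C.d (i + 1) c = 0 → ∃ b ∈ D.carrier i, C.d i b = c

theorem ExactAt.cone {D : C.Sub} {i : ℤ} (x : R) (h₀ : D.ExactAt i) (h₁ : D.ExactAt (i + 1)) :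
    (D.cone x).ExactAt i := by
  rintro ⟨a, b⟩ ⟨ha, hb⟩ h
  rw [cone_d_apply] at h
  have h1 : C.d (i + 1) a + x • b = 0 := congrArg Prod.fst h
  have h2 : C.d (i + 1 + 1) b = 0 := neg_eq_zero.mp (congrArg Prod.snd h)
  obtain ⟨β, hβ, rfl⟩ := h₁ b hb h2
  obtain ⟨α, hα, h3⟩ := h₀ (a + x • β) (add_mem ha (Submodule.smul_mem _ _ hβ))
    (by simpa using h1)
  exact ⟨(α, -β), ⟨hα, neg_mem hβ⟩, Prod.ext (by simp [h3]) (by simp)⟩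

/-- Each cone uses one further degree above, so `r` elements need `r + 1` consecutive degrees of
vanishing. -/
theorem exactAt_koszul (xs : List R) {D : C.Sub} {i : ℤ}
    (h : ∀ n : ℕ, n ≤ xs.length → D.ExactAt (i + n)) : (koszul xs D).ExactAt i := by
  induction xs generalizing C with
  | nil => simpa using! h 0
  | cons x xs ih =>
    refine ih fun n hn => (h n (hn.trans (by simp))).cone x ?_
    have := h (n + 1) (by simpa using hn)
    rwa [Nat.cast_add, Nat.cast_one, ← add_assoc] at this

/-- `D ≤ D'` and the quotient complex `D' / D` is acyclic. -/
structure RelAcyclic (D D' : C.Sub) : Prop where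
  le : ∀ i, D.carrier i ≤ D'.carrier i
  exact : ∀ i, ∀ c ∈ D'.carrier (i + 1), C.d (i + 1) c ∈ D.carrier (i + 1 + 1) →
    ∃ b ∈ D'.carrier i, c - C.d i b ∈ D.carrier (i + 1)

theorem RelAcyclic.refl (D : C.Sub) : RelAcyclic D D :=
  ⟨fun _ => le_rfl, fun _ c hc _ => ⟨0, zero_mem _, by simpa using hc⟩⟩

theorem RelAcyclic.trans {D D' D'' : C.Sub} (h : RelAcyclic D D') (h' : RelAcyclic D' D'') :
    RelAcyclic D D'' := by
  refine ⟨fun i => (h.le i).trans (h'.le i), fun i c hc hdc => ?_⟩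
  obtain ⟨b, hb, hcb⟩ := h'.exact i c hc (h.le _ hdc)
  obtain ⟨b', hb', hcb'⟩ := h.exact i (c - C.d i b) hcb (by simpa [C.d_d] using hdc)
  exact ⟨b + b', add_mem hb (h'.le _ hb'), by simpa [sub_sub] using hcb'⟩

theorem RelAcyclic.exactAt {D D' : C.Sub} (h : RelAcyclic D D') {i : ℤ} (hD : D.ExactAt i) :
    D'.ExactAt i := by
  intro c hc hdc
  obtain ⟨b, hb, hcb⟩ := h.exact i c hc (by simp [hdc])
  obtain ⟨b', hb', h'⟩ := hD _ hcb (by simp [C.d_d, hdc])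
  exact ⟨b + b', add_mem hb (h.le _ hb'), by simp [h']⟩

theorem RelAcyclic.cone {D D' : C.Sub} (h : RelAcyclic D D') (x : R) :
    RelAcyclic (D.cone x) (D'.cone x) := by
  refine ⟨fun i => Submodule.prod_mono (h.le _) (h.le _), ?_⟩
  rintro i ⟨a, b⟩ ⟨ha, hb⟩ ⟨h1, h2⟩
  change C.d (i + 1) a + x • b ∈ _ at h1
  change -C.d (i + 1 + 1) b ∈ _ at h2
  obtain ⟨β, hβ, hb'⟩ := h.exact (i + 1) b hb (by simpa using h2)
  obtain ⟨α, hα, ha'⟩ := h.exact i (a + x • β) (add_mem ha (Submodule.smul_mem _ _ hβ)) (by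
    have := sub_mem h1 (Submodule.smul_mem _ x hb')
    rwa [smul_sub, sub_sub_eq_add_sub, add_sub_right_comm, add_sub_cancel_right, ← map_smul,
      ← map_add] at this)
  refine ⟨(α, -β), ⟨hα, neg_mem hβ⟩, ?_, ?_⟩
  · change a - (C.d i α + x • -β) ∈ _
    rwa [smul_neg, ← sub_eq_add_neg, sub_sub_eq_add_sub]
  · change b - -C.d (i + 1) (-β) ∈ _
    simpa using hb'

theorem RelAcyclic.koszul (xs : List R) {D D' : C.Sub} (h : RelAcyclic D D') :
    RelAcyclic (D.koszul xs) (D'.koszul xs) := by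
  induction xs generalizing C with
  | nil => exact h
  | cons x xs ih => exact ih (h.cone x)

/-- `D ≤ D'` and `x` acts bijectively on the terms of the quotient complex `D' / D`. -/
structure RelBijective (x : R) (D D' : C.Sub) : Prop where
  le : ∀ i, D.carrier i ≤ D'.carrier i
  injective : ∀ i, ∀ c ∈ D'.carrier i, x • c ∈ D.carrier i → c ∈ D.carrier i
  surjective : ∀ i, ∀ c ∈ D'.carrier i, ∃ b ∈ D'.carrier i, c - x • b ∈ D.carrier i

theorem RelBijective.cone {x : R} {D D' : C.Sub} (h : RelBijective x D D') (y : R) :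
    RelBijective x (D.cone y) (D'.cone y) where
  le i := Submodule.prod_mono (h.le _) (h.le _)
  injective i c hc hxc := ⟨h.injective _ _ hc.1 hxc.1, h.injective _ _ hc.2 hxc.2⟩
  surjective i c hc := by
    obtain ⟨a, ha, ha'⟩ := h.surjective _ _ hc.1
    obtain ⟨b, hb, hb'⟩ := h.surjective _ _ hc.2
    exact ⟨(a, b), ⟨ha, hb⟩, ha', hb'⟩

/-- The cone of an isomorphism, here `x` acting on `D' / D`, is acyclic. -/
theorem RelBijective.relAcyclic_cone {x : R} {D D' : C.Sub} (h : RelBijective x D D') :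
    RelAcyclic (D.cone x) (D'.cone x) := by
  refine ⟨fun i => Submodule.prod_mono (h.le _) (h.le _), ?_⟩
  rintro i ⟨a, b⟩ ⟨ha, hb⟩ ⟨h1, h2⟩
  change C.d (i + 1) a + x • b ∈ _ at h1
  obtain ⟨β, hβ, hb'⟩ := h.surjective _ a ha
  refine ⟨(0, β), ⟨zero_mem _, hβ⟩, ?_, ?_⟩
  · change a - (C.d i 0 + x • β) ∈ _
    simpa using hb'
  · change b - -C.d (i + 1) β ∈ _
    refine h.injective _ _ (sub_mem hb (neg_mem (D'.d_mem _ _ hβ))) ?_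
    -- The difference of `d a + x • b` and `d (a - x • β)` is `x • (b + d β)`, from which `x` can be
    -- cancelled modulo `D`.
    have := sub_mem h1 (D.d_mem _ _ hb')
    convert this using 1
    simp only [map_sub, map_smul, smul_sub, smul_neg]
    abel

/-- One bijective entry suffices: cones on earlier entries preserve bijectivity, its own cone
creates acyclicity, and later cones preserve that. -/
theorem RelBijective.relAcyclic_koszul {xs : List R} {x : R} (hx : x ∈ xs) {D D' : C.Sub}
    (h : RelBijective x D D') : RelAcyclic (D.koszul xs) (D'.koszul xs) := by
  induction xs generalizing C with
  | nil => simp at hx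
  | cons y xs ih =>
    rcases List.mem_cons.mp hx with rfl | hx
    · exact h.relAcyclic_cone.koszul xs
    · exact ih hx (h.cone y)

/-- The whole complex as a subcomplex. -/
def top (C : ModComplex R) : C.Sub := ⟨fun _ => ⊤, fun _ _ _ => trivial⟩

theorem koszul_top (xs : List R) (C : ModComplex R) :
    (top C).koszul xs = top (ModComplex.koszul xs C) := by
  induction xs generalizing C with
  | nil => rfl
  | cons x xs ih =>
    have : (top C).cone x = top (C.cone x) := by
      simp only [top, cone, Submodule.prod_top]
      rfl
    change ((top C).cone x).koszul xs = top (ModComplex.koszul xs (C.cone x))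
    rw [this, ih]

/-- The subcomplex of `I`-power torsion elements. -/
def torsion (C : ModComplex R) (I : Ideal R) : C.Sub where
  carrier i := powerTorsion I (C.X i)
  d_mem i := by
    rintro c ⟨n, hn⟩
    exact ⟨n, fun a ha => by rw [← map_smul, hn a ha, map_zero]⟩

end Sub

end ModComplex

/-! ### Power torsion in injective modules -/

section Torsion

variable {R : Type u} [CommRing R] {E : Type u} [AddCommGroup E] [Module R E]

theorem powerTorsion_bot : powerTorsion (⊥ : Ideal R) E = ⊤ := by
  refine eq_top_iff.mpr fun e _ => ⟨1, fun a ha => ?_⟩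
  rw [pow_one, Ideal.mem_bot] at ha
  rw [ha, zero_smul]

theorem powerTorsion_anti {I J : Ideal R} (h : I ≤ J) : powerTorsion J E ≤ powerTorsion I E := by
  rintro e ⟨n, hn⟩
  exact ⟨n, fun a ha => hn a (Ideal.pow_right_mono h n ha)⟩

theorem powerTorsion_le_of_pow_le {I J : Ideal R} {n : ℕ} (h : I ^ n ≤ J) :
    powerTorsion J E ≤ powerTorsion I E := by
  rintro e ⟨p, hp⟩
  refine ⟨n * p, fun a ha => hp a (Ideal.pow_right_mono h p ?_)⟩
  rwa [← pow_mul]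

theorem mem_powerTorsion_sup_span {I : Ideal R} {x : R} {e : E} {n : ℕ}
    (he : e ∈ powerTorsion I E) (hx : x ^ n • e = 0) :
    e ∈ powerTorsion (I ⊔ Ideal.span {x}) E := by
  obtain ⟨m, hm⟩ := he
  refine ⟨m + n, fun a ha => ?_⟩
  obtain ⟨b, hb, c, hc, rfl⟩ := Submodule.mem_sup.mp (Ideal.sup_pow_add_le_pow_sup_pow ha)
  rw [Ideal.span_singleton_pow, Ideal.mem_span_singleton'] at hc
  obtain ⟨c, rfl⟩ := hc
  rw [add_smul, hm b hb, mul_smul, hx, smul_zero, add_zero]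

theorem exists_pow_smul_eq_zero_of_mem {I : Ideal R} {x : R} {e : E} (hx : x ∈ I)
    (he : e ∈ powerTorsion I E) : ∃ n : ℕ, x ^ n • e = 0 := by
  obtain ⟨n, hn⟩ := he
  exact ⟨n, hn _ (Ideal.pow_mem_pow hx n)⟩

theorem mem_powerTorsion_of_smul_mem {I : Ideal R} {x : R} {e : E}
    (he : e ∈ powerTorsion I E) (hx : x • e ∈ powerTorsion (I ⊔ Ideal.span {x}) E) :
    e ∈ powerTorsion (I ⊔ Ideal.span {x}) E := by
  obtain ⟨n, hn⟩ := exists_pow_smul_eq_zero_of_mem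
    (Ideal.mem_sup_right (Ideal.mem_span_singleton_self x)) hx
  exact mem_powerTorsion_sup_span (n := n + 1) he (by rwa [pow_succ, mul_smul])

/-- A linear map from `I ⊔ (y)` to an injective module, zero on `I` and prescribed at `y`, is
given by an element. -/
theorem exists_smul_eq_of_injective [Module.Injective R E] {I : Ideal R} {y : R}
    {e : E} (h : ∀ r, r * y ∈ I → r • e = 0) : ∃ e' : E, y • e' = e ∧ ∀ a ∈ I, a • e' = 0 := by
  let φ : R →ₗ[R] R ⧸ I := (LinearMap.toSpanSingleton R (R ⧸ I) (Ideal.Quotient.mk I y))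
  have hφ : ∀ r, φ r = Ideal.Quotient.mk I (r * y) := fun r => rfl
  have hker : LinearMap.ker φ ≤ LinearMap.ker (LinearMap.toSpanSingleton R E e) := by
    intro r hr
    rw [LinearMap.mem_ker, hφ, Ideal.Quotient.eq_zero_iff_mem] at hr
    exact h r hr
  -- `r ↦ r * y` embeds `R ⧸ ker φ` in `R ⧸ I`; extending `r ↦ r • e` along it, the image of `1` is
  -- the required element.
  let ψ : (R ⧸ LinearMap.ker φ) →ₗ[R] R ⧸ I := (LinearMap.ker φ).liftQ φ le_rfl
  have hψ : Function.Injective ψ := by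
    rw [← LinearMap.ker_eq_bot]
    exact Submodule.ker_liftQ_eq_bot _ _ _ le_rfl
  obtain ⟨g, hg⟩ := Module.Injective.out ψ hψ ((LinearMap.ker φ).liftQ _ hker)
  refine ⟨g (Ideal.Quotient.mk I 1), ?_, fun a ha => ?_⟩
  · have := hg (Submodule.Quotient.mk 1)
    rw [Submodule.liftQ_apply, Submodule.liftQ_apply, hφ, LinearMap.toSpanSingleton_apply,
      one_smul, one_mul] at this
    rw [← this, ← map_smul]
    congr 1
    change Ideal.Quotient.mk I (y * 1) = _
    rw [mul_one]
  · rw [← map_smul]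
    change g (Ideal.Quotient.mk I (a * 1)) = 0
    rw [mul_one, Ideal.Quotient.eq_zero_iff_mem.mpr ha, map_zero]

/-- Multiplication by `x` is surjective on `Γ_I E / Γ_{I + (x)} E` for `E` injective over a
noetherian ring. -/
theorem exists_sub_smul_mem_powerTorsion [IsNoetherianRing R] [Module.Injective R E] (I : Ideal R)
    (x : R) {e : E} (he : e ∈ powerTorsion I E) :
    ∃ e' ∈ powerTorsion I E, e - x • e' ∈ powerTorsion (I ⊔ Ideal.span {x}) E := by
  obtain ⟨m, hm⟩ := id he
  -- From `n` on, the annihilators of the powers of `x` are constant.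
  obtain ⟨n, hn⟩ := monotone_stabilizes_iff_noetherian.mpr (inferInstance : IsNoetherian R R)
    ⟨fun n => LinearMap.ker (LinearMap.mulLeft R (x ^ n)), monotone_nat_of_le_succ fun n r hr => by
      simp only [LinearMap.mem_ker, LinearMap.mulLeft_apply] at hr ⊢
      rw [pow_succ', mul_assoc, hr, mul_zero]⟩
  obtain ⟨k, hk⟩ := Ideal.exists_pow_inf_eq_pow_smul I
    (Ideal.span {x ^ (n + 1)} : Submodule R R)
  -- Solving `x ^ (n + 1) • e' = x ^ n • e` makes `x ^ n` kill `e - x • e'`. For consistency: if `r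
  -- * x ^ (n + 1) ∈ I ^ (m + k)`, Artin–Rees replaces `r` by some `s ∈ I ^ m` with the same
  -- product; by stability `r * x ^ n = s * x ^ n`, and `s` kills `e`.
  obtain ⟨e', h1, h2⟩ := exists_smul_eq_of_injective (I := I ^ (m + k)) (y := x ^ (n + 1))
    (e := x ^ n • e) (by
      intro r hr
      have hr' : r * x ^ (n + 1) ∈ (I ^ (m + k) • ⊤ ⊓ Ideal.span {x ^ (n + 1)} : Submodule R R) :=
        ⟨by simpa using! hr, Ideal.mul_mem_left _ _ (Ideal.mem_span_singleton_self _)⟩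
      rw [hk (m + k) (by lia), Nat.add_sub_cancel] at hr'
      have hr'' : r * x ^ (n + 1) ∈ I ^ m * Ideal.span {x ^ (n + 1)} :=
        Ideal.mul_mono_right inf_le_right hr'
      obtain ⟨s, hs, hs'⟩ := Ideal.mem_mul_span_singleton.mp hr''
      have h3 : r - s ∈ LinearMap.ker (LinearMap.mulLeft R (x ^ (n + 1))) := by
        rw [LinearMap.mem_ker, LinearMap.mulLeft_apply, mul_sub, mul_comm, ← hs', mul_comm, sub_self]
      have h4 : r - s ∈ LinearMap.ker (LinearMap.mulLeft R (x ^ n)) := by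
        have := hn (n + 1) (by lia)
        change LinearMap.ker _ = LinearMap.ker _ at this
        rwa [this]
      rw [LinearMap.mem_ker, LinearMap.mulLeft_apply, mul_sub, sub_eq_zero] at h4
      rw [smul_smul, mul_comm, h4, mul_smul, hm s hs, smul_zero])
  refine ⟨e', ⟨_, h2⟩, mem_powerTorsion_sup_span (n := n)
    (sub_mem he (Submodule.smul_mem _ _ ⟨_, h2⟩)) ?_⟩
  rw [smul_sub, smul_smul, ← pow_succ, h1, sub_self]

end Torsion

/-! ### Comparing torsion and the whole complex; passage to Mathlib homology -/

namespace ModComplex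

variable {R : Type u} [CommRing R]

theorem Sub.relBijective_torsion [IsNoetherianRing R] {C : ModComplex R}
    (hC : ∀ i, Module.Injective R (C.X i)) (I : Ideal R) (x : R) :
    Sub.RelBijective x (torsion C (I ⊔ Ideal.span {x})) (torsion C I) where
  le _ := powerTorsion_anti le_sup_left
  injective _ _ hc hxc := mem_powerTorsion_of_smul_mem hc hxc
  surjective i _ hc :=
    have := hC i
    exists_sub_smul_mem_powerTorsion I x hc

theorem Sub.torsion_bot (C : ModComplex R) : torsion C ⊥ = top C := by
  simp only [torsion, top, powerTorsion_bot]

/-- For a complex `C` of injective modules, the Koszul complexes on `xs` with coefficients in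
`Γ_{(ys)} C` and `C` are quasi-isomorphic, for `ys ⊆ xs`. -/
theorem Sub.relAcyclic_koszul_torsion [IsNoetherianRing R] {C : ModComplex R}
    (hC : ∀ i, Module.Injective R (C.X i)) (xs ys : List R) (h : ys ⊆ xs) :
    Sub.RelAcyclic ((torsion C (Ideal.ofList ys)).koszul xs) ((top C).koszul xs) := by
  induction ys with
  | nil =>
    rw [Ideal.ofList_nil, torsion_bot]
    exact .refl _
  | cons y ys ih =>
    rw [List.cons_subset] at h
    rw [Ideal.ofList_cons, sup_comm]
    -- Enlarging the ideal by `y` changes the torsion by a quotient on which `y ∈ xs` is bijective,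
    -- so the Koszul complex on `xs` does not see it.
    exact ((relBijective_torsion hC _ y).relAcyclic_koszul h.1).trans (ih h.2)

/-- If `C` is a complex of injective modules with finitely generated cohomology, and the
cohomology of `Γ_{(xs)} C` vanishes in the degrees `i + 1, …, i + 1 + n`, where `n` is the length
of `xs`, then that of `C` vanishes in degree `i + 1`. -/
theorem subsingleton_cohomology_of_exactAt_torsion [IsLocalRing R] [IsNoetherianRing R]
    {C : ModComplex R} (hC : ∀ i, Module.Injective R (C.X i))
    (hfin : ∀ i, IsNoetherian R (C.cohomology i)) {xs : List R}
    (hx : ∀ x ∈ xs, x ∈ IsLocalRing.maximalIdeal R) {i : ℤ}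
    (h : ∀ n : ℕ, n ≤ xs.length → (Sub.torsion C (Ideal.ofList xs)).ExactAt (i + n)) :
    Subsingleton (C.cohomology i) := by
  refine subsingleton_cohomology_of_koszul xs hx hfin (subsingleton_cohomology_iff.mpr ?_)
  have := (Sub.relAcyclic_koszul_torsion hC xs xs (List.Subset.refl _)).exactAt
    (Sub.exactAt_koszul xs h)
  rw [Sub.koszul_top] at this
  intro c hc
  obtain ⟨b, -, hb⟩ := this c trivial hc
  exact ⟨b, hb⟩

/-- The terms and differentials of a cochain complex. -/
def ofCochainComplex (K : CochainComplex (ModuleCat.{u} R) ℤ) : ModComplex R where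
  X i := K.X i
  d i := (K.d i (i + 1)).hom
  d_d i x := by
    change (K.d i (i + 1) ≫ K.d (i + 1) (i + 1 + 1)).hom x = 0
    simp

/-- The cohomology of a cochain complex in terms of cycles and boundaries. -/
noncomputable def homologyEquiv (K : CochainComplex (ModuleCat.{u} R) ℤ) (i : ℤ) :
    K.homology (i + 1) ≃ₗ[R] (ofCochainComplex K).cohomology i :=
  (K.homologyIsoSc' i (i + 1) (i + 1 + 1) (by simp) (by simp) ≪≫
    (K.sc' i (i + 1) (i + 1 + 1)).moduleCatHomologyIso).toLinearEquiv

theorem isZero_homology_iff (K : CochainComplex (ModuleCat.{u} R) ℤ) (i : ℤ) :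
    Limits.IsZero (K.homology (i + 1)) ↔ Subsingleton ((ofCochainComplex K).cohomology i) := by
  rw [ModuleCat.isZero_iff_subsingleton]
  exact (homologyEquiv K i).toEquiv.subsingleton_congr

theorem exactAt_torsion_iff (K : CochainComplex (ModuleCat.{u} R) ℤ) (I : Ideal R) (i : ℤ) :
    (Sub.torsion (ofCochainComplex K) I).ExactAt i ↔ Limits.IsZero
      ((((torsionFunctor I).mapHomologicalComplex (ComplexShape.up ℤ)).obj K).homology (i + 1)) := by
  rw [isZero_homology_iff, subsingleton_cohomology_iff]
  constructor
  · rintro h ⟨c, hc⟩ hdc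
    obtain ⟨b, hb, hbc⟩ := h c hc (congrArg Subtype.val hdc)
    exact ⟨⟨b, hb⟩, Subtype.ext hbc⟩
  · intro h c hc hdc
    obtain ⟨⟨b, hb⟩, hbc⟩ := h ⟨c, hc⟩ (Subtype.ext hdc)
    exact ⟨b, hb, congrArg Subtype.val hbc⟩

end ModComplex

/-! ### Systems of parameters and the conclusion -/

/-- A noetherian local ring has a system of parameters. -/
theorem exists_system_of_parameters (R : Type u) [CommRing R] [IsLocalRing R]
    [IsNoetherianRing R] :
    ∃ xs : List R, (xs.length : ℤ) = dim R ∧ (∀ x ∈ xs, x ∈ IsLocalRing.maximalIdeal R) ∧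
      ∃ n : ℕ, IsLocalRing.maximalIdeal R ^ n ≤ Ideal.ofList xs := by
  obtain ⟨d, hd, hd'⟩ := coe_dim R
  -- Converse of Krull's height theorem: `𝔪` is minimal over an ideal with height-many generators.
  obtain ⟨s, hs, hcard⟩ := (IsLocalRing.maximalIdeal R).exists_finset_card_eq_height_of_isNoetherianRing
  have hlist : Ideal.ofList s.toList = Ideal.span s := by
    simp [Ideal.ofList]
  refine ⟨s.toList, ?_, fun x hx => hs.1.2 (Ideal.subset_span (by simpa using hx)), ?_⟩
  · rw [hd', Finset.length_toList]
    rw [← IsLocalRing.maximalIdeal_height_eq_ringKrullDim, ← hcard] at hd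
    exact_mod_cast hd
  · rw [hlist]
    refine Ideal.exists_pow_le_of_le_radical_of_fg ?_ (IsNoetherian.noetherian _)
    rw [Ideal.radical_eq_sInf]
    -- Every prime over the ideal lies in `𝔪`, hence equals `𝔪` by minimality.
    refine le_sInf fun p hp => hs.2 ⟨hp.2, hp.1⟩ (IsLocalRing.le_maximalIdeal hp.2.ne_top)

/-- Allows `𝔪` to be replaced by a parameter ideal, whose `dim R` generators keep the Koszul window
short enough. -/
theorem powerTorsion_eq_of_pow_le {R : Type u} [CommRing R] {I J : Ideal R} (h : I ≤ J) {n : ℕ}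
    (hn : J ^ n ≤ I) (E : Type u) [AddCommGroup E] [Module R E] :
    powerTorsion I E = powerTorsion J E :=
  le_antisymm (powerTorsion_le_of_pow_le hn) (powerTorsion_anti h)

end MCM

theorem mainTheorem11 (R : Type u) [CommRing R] [IsLocalRing R] [IsNoetherianRing R]
    (M : CochainComplex (ModuleCat.{u} R) ℤ) (hM : MCM.IsMaximalCohenMacaulay M) :
    (∀ i : ℤ, i ∉ Set.Icc 0 (MCM.dim R) → Limits.IsZero (M.homology i)) ∧
      ¬ Limits.IsZero (M.homology 0) := by
  refine ⟨fun i hi => ?_, fun h => ?_⟩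
  · obtain ⟨J, hJ⟩ := hM.localCohomology_isZero
    obtain ⟨xs, hlen, hxs, n, hn⟩ := MCM.exists_system_of_parameters R
    have hle : Ideal.ofList xs ≤ IsLocalRing.maximalIdeal R := Ideal.span_le.mpr hxs
    have := J.quasiIso
    have e (j : ℤ) : M.homology j ≅ J.J.homology j :=
      asIso (HomologicalComplex.homologyMap J.ι j)
    -- `cohomology i` and `ExactAt i` refer to degree `i + 1`.
    obtain ⟨i, rfl⟩ : ∃ j, i = j + 1 := ⟨i - 1, by lia⟩
    rw [(e (i + 1)).isZero_iff, MCM.ModComplex.isZero_homology_iff]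
    refine MCM.ModComplex.subsingleton_cohomology_of_exactAt_torsion (xs := xs)
      (fun j => (Module.injective_iff_injective_object R _).mpr (J.injective j))
      (fun j => ?_) hxs (fun p hp => ?_)
    · have := hM.finite (j + 1)
      exact isNoetherian_of_linearEquiv
        ((e (j + 1)).toLinearEquiv.trans (MCM.ModComplex.homologyEquiv J.J j))
    · have heq : MCM.ModComplex.Sub.torsion (MCM.ModComplex.ofCochainComplex J.J)
          (Ideal.ofList xs) = MCM.ModComplex.Sub.torsion _ (IsLocalRing.maximalIdeal R) := by
        simp only [MCM.ModComplex.Sub.torsion, MCM.powerTorsion_eq_of_pow_le hle hn]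
      rw [heq, MCM.ModComplex.exactAt_torsion_iff]
      -- If `i + p + 1 = dim R` with `0 ≤ p ≤ dim R`, then `i + 1` lies in the excluded interval.
      refine hJ _ fun h => hi ?_
      rw [Set.mem_Icc]
      lia
  · obtain ⟨P, hP⟩ := hM.residueMap_ne_zero
    exact hP (h.eq_of_src _ _)
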